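/- All graphs are finite and simple. A graph is subcubic if every vertex has degree at most $3$. The exact square chromatic number $\chi^{[\sharp 2]}(G)$ of a graph $G$ is the least number of colors in a coloring of the vertices of $G$ in which any two vertices at distance exactly $2$ receive distinct colors (adjacent vertices may share a color). A graph is outerplanar if it can be drawn in the plane without crossings so that every vertex lies on the boundary of the outer (unbounded) face. Theorem. Every subcubic $K_4$-minor-free graph $G$ satisfies $\chi^{[\sharp 2]}(G)\le 4$. The bound is tight, both for bipartite graphs of girth at least $6$ and for outerplanar graphs: there is a bipartite subcubic $K_4$-minor-free graph $G$ of girth at least $6$ with $\chi^{[\sharp 2]}(G)=4$, and there is an outerplanar subcubic $K_4$-minor-free graph $G$ with $\chi^{[\sharp 2]}(G)=4$. -/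

import Mathlib

/-- The exact square of `G`: two vertices are joined when their distance in `G` is exactly `2`. -/
def SimpleGraph.exactSquare {V : Type*} (G : SimpleGraph V) : SimpleGraph V where
  Adj u v := G.dist u v = 2
  symm := ⟨fun u v h => by rw [SimpleGraph.dist_comm]; exact h⟩
  loopless := ⟨fun v h => by simp at h⟩

/-- The exact square chromatic number: the least number of colors in a vertex coloring in which
any two vertices at distance exactly `2` receive distinct colors. -/
noncomputable def SimpleGraph.exactSquareChromaticNumber {V : Type*} (G : SimpleGraph V) : ℕ∞ :=
  G.exactSquare.chromaticNumber

/-- Every vertex has degree at most `3`. -/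
def SimpleGraph.IsSubcubic {V : Type*} (G : SimpleGraph V) : Prop :=
  ∀ v : V, (G.neighborSet v).encard ≤ 3

/-- `H` is a minor of `G`: there are pairwise disjoint branch sets in `G`, one for each vertex of
`H`, each inducing a connected (hence nonempty) subgraph, such that adjacent vertices of `H` have
branch sets joined by at least one edge of `G`. -/
def SimpleGraph.IsMinorOf {W V : Type*} (H : SimpleGraph W) (G : SimpleGraph V) : Prop :=
  ∃ B : W → Set V,
    (∀ w, (G.induce (B w)).Connected) ∧
    (∀ w w', w ≠ w' → Disjoint (B w) (B w')) ∧
    ∀ w w', H.Adj w w' → ∃ x ∈ B w, ∃ y ∈ B w', G.Adj x y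

/-- The complete graph on four vertices is not a minor of `G`. -/
def SimpleGraph.IsK4MinorFree {V : Type*} (G : SimpleGraph V) : Prop :=
  ¬ (completeGraph (Fin 4)).IsMinorOf G

/-- A plane drawing of `G` without crossings: vertices are distinct points of the plane, edges are
simple arcs joining their ends, an edge contains no vertex other than its ends, and two distinct
edges meet at most in common ends. (The value of `arc` outside the edge set is irrelevant.) -/
structure SimpleGraph.PlaneDrawing {V : Type*} (G : SimpleGraph V) where
  pt : V → EuclideanSpace ℝ (Fin 2)
  arc : Sym2 V → Set (EuclideanSpace ℝ (Fin 2))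
  pt_injective : Function.Injective pt
  arc_eq_range : ∀ u v, G.Adj u v →
    ∃ γ : _root_.Path (pt u) (pt v), Function.Injective γ ∧ Set.range γ = arc s(u, v)
  mem_of_pt_mem_arc : ∀ e ∈ G.edgeSet, ∀ v, pt v ∈ arc e → v ∈ e
  arc_inter_arc : ∀ e ∈ G.edgeSet, ∀ e' ∈ G.edgeSet, e ≠ e' →
    arc e ∩ arc e' ⊆ pt '' {v | v ∈ e ∧ v ∈ e'}

/-- The point set of the plane covered by the drawing. -/
def SimpleGraph.PlaneDrawing.support {V : Type*} {G : SimpleGraph V} (D : G.PlaneDrawing) :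
    Set (EuclideanSpace ℝ (Fin 2)) :=
  Set.range D.pt ∪ ⋃ e ∈ G.edgeSet, D.arc e

/-- A face of the drawing is a connected component of the complement of the drawing. -/
def SimpleGraph.PlaneDrawing.IsFace {V : Type*} {G : SimpleGraph V} (D : G.PlaneDrawing)
    (F : Set (EuclideanSpace ℝ (Fin 2))) : Prop :=
  ∃ x ∈ D.supportᶜ, F = connectedComponentIn D.supportᶜ x

/-- `G` is outerplanar: it has a plane drawing without crossings in which every vertex lies on the
boundary of the outer (unbounded) face. -/
def SimpleGraph.IsOuterplanar {V : Type*} (G : SimpleGraph V) : Prop :=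
  ∃ (D : G.PlaneDrawing) (F : Set (EuclideanSpace ℝ (Fin 2))),
    D.IsFace F ∧ ¬ Bornology.IsBounded F ∧ ∀ v, D.pt v ∈ frontier F

/-!
A vertex with at most three vertices at distance two can be colored last, provided that its
deletion keeps all other pairs at distance two. In a subcubic graph this takes care of a vertex of
degree at most one, of a vertex of degree two on a triangle or on a 4-cycle, and of two adjacent
vertices of degree two, deleted together. If none of these occurs, suppressing the vertices of
degree two creates neither loops nor parallel edges, so it yields a minor of minimum degree at
least three. Such a graph has a `K₄` minor: among all longest paths, take one with the shortest
cycle closed by an edge at its first vertex. If `c` is the last vertex of the path on this cycle,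
then both neighbors of `c` on the cycle are joined to the part of the path beyond `c`.

For the lower bounds, the exact square of the theta graph contains `K₄`, and a 3-coloring of the
exact square of the pentagon graph is refuted by propagating colors from face to face. Chords of a
parabola that do not interleave form an outerplanar drawing, since the region below the parabola
lies in the outer face.
-/

namespace ExactSquareColoring

open SimpleGraph

variable {V W U : Type*} {G : SimpleGraph V} {H : SimpleGraph W} {K : SimpleGraph U}

/-! ### Minors -/

theorem reachable_map_of_forall_adj {f : V → W}
    (hf : ∀ a b, G.Adj a b → H.Reachable (f a) (f b)) {u v : V} (huv : G.Reachable u v) :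
    H.Reachable (f u) (f v) := by
  obtain ⟨p⟩ := huv
  induction p with
  | nil => rfl
  | cons hab _ ih => exact (hf _ _ hab).trans ih

theorem connected_induce_of_forall_adj {S : Set V} {u : V} (hu : u ∈ S)
    (hS : ∀ v ∈ S, v ≠ u → G.Adj u v) : (G.induce S).Connected := by
  refine connected_iff_exists_forall_reachable _ |>.2 ⟨⟨u, hu⟩, fun ⟨v, hv⟩ => ?_⟩
  obtain rfl | hvu := eq_or_ne v u
  · rfl
  · exact Adj.reachable (G := G.induce S) (hS v hv hvu)

theorem connected_induce_biUnion {S : Set U} {C : U → Set V} (hS : (K.induce S).Connected)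
    (hC : ∀ k, (G.induce (C k)).Connected)
    (hadj : ∀ k k', K.Adj k k' → ∃ x ∈ C k, ∃ y ∈ C k', G.Adj x y) :
    (G.induce (⋃ k ∈ S, C k)).Connected := by
  have hsub : ∀ k ∈ S, C k ⊆ ⋃ k ∈ S, C k := fun k hk => Set.subset_biUnion_of_mem hk
  have hreach : ∀ k (hk : k ∈ S) x (hx : x ∈ C k) y (hy : y ∈ C k),
      (G.induce (⋃ k ∈ S, C k)).Reachable ⟨x, hsub k hk hx⟩ ⟨y, hsub k hk hy⟩ :=
    fun k hk x hx y hy => ((hC k).preconnected ⟨x, hx⟩ ⟨y, hy⟩).map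
      (induceHomOfLE G (hsub k hk)).toHom
  choose r hr using fun k => Set.nonempty_coe_sort.1 (hC k).nonempty
  have htransport : ∀ k k' : S, (K.induce S).Adj k k' → (G.induce (⋃ k ∈ S, C k)).Reachable
      ⟨r k, hsub k k.2 (hr k)⟩ ⟨r k', hsub k' k'.2 (hr k')⟩ := by
    rintro ⟨k, hk⟩ ⟨k', hk'⟩ hkk'
    obtain ⟨x, hx, y, hy, hxy⟩ := hadj k k' hkk'
    exact (hreach k hk _ (hr k) x hx).trans <|
      (Adj.reachable (G := G.induce _) (by exact hxy)).trans (hreach k' hk' y hy _ (hr k'))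
  obtain ⟨k₀, hk₀⟩ := Set.nonempty_coe_sort.1 hS.nonempty
  refine connected_iff_exists_forall_reachable _ |>.2 ⟨⟨r k₀, hsub k₀ hk₀ (hr k₀)⟩, ?_⟩
  rintro ⟨x, hx⟩
  obtain ⟨k, hk, hxk⟩ := Set.mem_iUnion₂.1 hx
  exact (reachable_map_of_forall_adj htransport (hS.preconnected ⟨k₀, hk₀⟩ ⟨k, hk⟩)).trans
    (hreach k hk _ (hr k) x hxk)

/-- The branch sets `B` exhibit `H` as a minor of `G`. -/
structure IsMinorModel (H : SimpleGraph W) (G : SimpleGraph V) (B : W → Set V) : Prop where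
  connected : ∀ w, (G.induce (B w)).Connected
  disjoint : Pairwise fun w w' => Disjoint (B w) (B w')
  exists_adj : ∀ w w', H.Adj w w' → ∃ x ∈ B w, ∃ y ∈ B w', G.Adj x y

theorem isMinorOf_iff_exists_isMinorModel : H.IsMinorOf G ↔ ∃ B, IsMinorModel H G B :=
  exists_congr fun _ => ⟨fun ⟨hc, hd, ha⟩ => ⟨hc, hd, ha⟩, fun ⟨hc, hd, ha⟩ => ⟨hc, hd, ha⟩⟩

theorem IsMinorModel.trans {B : W → Set U} {C : U → Set V} (hB : IsMinorModel H K B)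
    (hC : IsMinorModel K G C) : IsMinorModel H G fun w => ⋃ k ∈ B w, C k where
  connected w := connected_induce_biUnion (hB.connected w) hC.connected hC.exists_adj
  disjoint w w' hne := by
    simp only [Set.disjoint_iUnion_left, Set.disjoint_iUnion_right]
    exact fun k' hk' k hk => hC.disjoint <|
      (hB.disjoint hne).ne_of_mem hk hk'
  exists_adj w w' hww' := by
    obtain ⟨k, hk, k', hk', hkk'⟩ := hB.exists_adj w w' hww'
    obtain ⟨x, hx, y, hy, hxy⟩ := hC.exists_adj k k' hkk'
    exact ⟨x, Set.mem_biUnion hk hx, y, Set.mem_biUnion hk' hy, hxy⟩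

theorem isMinorOf_trans (hHK : H.IsMinorOf K) (hKG : K.IsMinorOf G) : H.IsMinorOf G := by
  rw [isMinorOf_iff_exists_isMinorModel] at *
  obtain ⟨B, hB⟩ := hHK
  obtain ⟨C, hC⟩ := hKG
  exact ⟨_, hB.trans hC⟩

theorem isMinorOf_of_isContained (h : H ⊑ G) : H.IsMinorOf G := by
  obtain ⟨f⟩ := h
  refine isMinorOf_iff_exists_isMinorModel.2 ⟨fun w => {f w}, ?_, ?_, ?_⟩
  · exact fun w => connected_induce_of_forall_adj rfl fun v hv hvw => absurd hv hvw
  · exact fun w w' hne => Set.disjoint_singleton.2 (f.injective.ne hne)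
  · exact fun w w' hww' => ⟨f w, rfl, f w', rfl, f.toHom.map_adj hww'⟩

theorem isK4MinorFree_of_isContained (hG : G.IsK4MinorFree) (h : H ⊑ G) : H.IsK4MinorFree :=
  fun hH => hG (isMinorOf_trans hH (isMinorOf_of_isContained h))

theorem isMinorModel_top_of_lt [LinearOrder W] {B : W → Set V}
    (hc : ∀ w, (G.induce (B w)).Connected) (hd : ∀ w w', w < w' → Disjoint (B w) (B w'))
    (ha : ∀ w w', w < w' → ∃ x ∈ B w, ∃ y ∈ B w', G.Adj x y) : IsMinorModel ⊤ G B where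
  connected := hc
  disjoint w w' hne := hne.lt_or_gt.elim (hd w w') fun h => (hd w' w h).symm
  exists_adj w w' hww' := hww'.ne.lt_or_gt.elim (ha w w') fun h =>
    let ⟨x, hx, y, hy, hxy⟩ := ha w' w h
    ⟨y, hy, x, hx, hxy.symm⟩

/-! ### Longest paths and `K₄` minors -/

theorem exists_mem_ne_ne_of_three_le_encard {α : Type*} {s : Set α} (hs : 3 ≤ s.encard) (p q : α) :
    ∃ w ∈ s, w ≠ p ∧ w ≠ q := by
  by_contra! hno
  have hsub : s ⊆ {p, q} := fun w hw => or_iff_not_imp_left.2 (hno w hw)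
  have hle : s.encard ≤ 1 + 1 := calc
    s.encard ≤ ({p, q} : Set α).encard := Set.encard_le_encard hsub
    _ ≤ ({q} : Set α).encard + 1 := Set.encard_insert_le _ _
    _ = 1 + 1 := by rw [Set.encard_singleton]
  exact absurd (hs.trans hle) (by decide)

theorem connected_induce_of_isChain {l : List V} (hne : l ≠ []) (hl : l.IsChain G.Adj) :
    (G.induce {x | x ∈ l}).Connected := by
  have := (Walk.ofSupport l hne hl).connected_induce_support
  rwa [Walk.support_ofSupport] at this

theorem completeGraph_four_isMinorOf_of_isChain {a z c d w w' : V} {A C : List V}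
    (hch : (a :: A ++ z :: c :: d :: C).IsChain G.Adj) (hnd : (a :: A ++ z :: c :: d :: C).Nodup)
    (hac : G.Adj a c) (hw : w ∈ d :: C) (haw : G.Adj a w) (hw' : w' ∈ d :: C) (hzw' : G.Adj z w') :
    (completeGraph (Fin 4)).IsMinorOf G := by
  obtain ⟨hA, hzcC, hAz⟩ := List.isChain_append.1 hch
  simp only [List.isChain_cons_cons] at hzcC
  obtain ⟨hzc, hcd, hC⟩ := hzcC
  have hlast : (a :: A).getLast (by simp) ∈ a :: A := List.getLast_mem _
  have hlast_z : G.Adj ((a :: A).getLast (by simp)) z :=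
    hAz _ (by simp [List.getLast?_eq_getLast_of_ne_nil]) z (by simp)
  refine isMinorOf_iff_exists_isMinorModel.2
    ⟨![{x | x ∈ a :: A}, {x | x ∈ [z]}, {x | x ∈ [c]}, {x | x ∈ d :: C}],
      isMinorModel_top_of_lt (fun i => ?_) (fun i j hij => ?_) fun i j hij => ?_⟩
  · fin_cases i
    exacts [connected_induce_of_isChain (by simp) hA,
      connected_induce_of_isChain (by simp) (.singleton z),
      connected_induce_of_isChain (by simp) (.singleton c),
      connected_induce_of_isChain (by simp) hC]
  · rw [Set.disjoint_left]
    fin_cases i <;> fin_cases j <;> first | exact absurd hij (by decide) | skip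
    all_goals
      simp only [Fin.reduceFinMk, Matrix.cons_val, Set.mem_ofPred_eq]
      grind
  · fin_cases i <;> fin_cases j <;> first | exact absurd hij (by decide) | skip
    exacts [⟨_, hlast, z, by simp, hlast_z⟩, ⟨a, by simp, c, by simp, hac⟩,
      ⟨a, by simp, w, hw, haw⟩, ⟨z, by simp, c, by simp, hzc⟩, ⟨z, by simp, w', hw', hzw'⟩,
      ⟨c, by simp, d, by simp, hcd⟩]

/-- The list `A ++ C` is a longest path of `G`, and the first vertex of `A` is joined to the first
vertex of `C`, so that the vertices of `A` and the first one of `C` form a cycle: the loop of the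
lasso, whose size is `A.length + 1`. -/
structure IsLasso (G : SimpleGraph V) (A C : List V) : Prop where
  isChain : (A ++ C).IsChain G.Adj
  nodup : (A ++ C).Nodup
  longest : ∀ l : List V, l.IsChain G.Adj → l.Nodup → l.length ≤ (A ++ C).length
  two_le_length : 2 ≤ A.length
  exists_adj_head : ∃ a ∈ A.head?, ∃ c ∈ C.head?, G.Adj a c

theorem IsLasso.reverse {A C : List V} (h : IsLasso G A C) : IsLasso G A.reverse C := by
  obtain ⟨a, ha, c, hc, hac⟩ := h.exists_adj_head
  obtain ⟨hA, hC, hAC⟩ := List.isChain_append.1 h.isChain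
  have hne : A ≠ [] := by rintro rfl; simp at ha
  have hlast : A.getLast hne ∈ A.getLast? := by simp [List.getLast?_eq_getLast_of_ne_nil hne]
  refine ⟨List.isChain_append.2 ⟨?_, hC, ?_⟩, ?_, by simpa using h.longest,
    by simpa using h.two_le_length, A.getLast hne, by simpa using hlast, c, hc,
    hAC _ hlast c hc⟩
  · exact List.isChain_reverse.2 (hA.imp fun _ _ hxy => hxy.symm)
  · intro x hx y hy
    rw [List.getLast?_reverse] at hx
    rwa [Option.mem_unique hx ha, Option.mem_unique hy hc]
  · exact ((List.reverse_perm A).append_right C).nodup_iff.2 h.nodup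

theorem IsLasso.exists_adj_mem_tail {A C : List V} (h : IsLasso G A C)
    (hmin : ∀ A' C', IsLasso G A' C' → A.length ≤ A'.length)
    (hdeg : ∀ v, 3 ≤ (G.neighborSet v).encard) :
    ∃ a ∈ A.head?, ∃ w ∈ C.tail, G.Adj a w := by
  obtain ⟨hch, hnd, hlong, hlen, a, ha, c, hc, -⟩ := h
  obtain ⟨b, A, rfl⟩ : ∃ b A', A = a :: b :: A' := by
    match A, hlen, ha with
    | _ :: b :: A', _, rfl => exact ⟨b, A', rfl⟩
  obtain ⟨C, rfl⟩ := List.head?_eq_some_iff.1 hc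
  obtain ⟨w, haw, hwb, hwc⟩ := exists_mem_ne_ne_of_three_le_encard (hdeg a) b c
  refine ⟨a, ha, w, ?_, haw⟩
  by_contra hwC
  by_cases hwA : w ∈ A
  · -- a neighbour of `a` inside the loop would cut off a smaller loop
    obtain ⟨X, Y, rfl⟩ := List.append_of_mem hwA
    have := hmin (a :: b :: X) (w :: Y ++ c :: C)
      ⟨by simpa using hch, by simpa using hnd, by simpa using hlong, by simp,
        a, by simp, w, by simp, haw⟩
    simp at this
  · -- a neighbour of `a` off the path would prolong it
    have := hlong (w :: (a :: b :: A ++ c :: C))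
      (List.isChain_cons.2 ⟨by simpa using haw.symm, hch⟩)
      (List.nodup_cons.2 ⟨by simp_all [haw.ne'], hnd⟩)
    simp at this

theorem IsLasso.completeGraph_four_isMinorOf {A C : List V} (h : IsLasso G A C)
    (hmin : ∀ A' C', IsLasso G A' C' → A.length ≤ A'.length)
    (hdeg : ∀ v, 3 ≤ (G.neighborSet v).encard) :
    (completeGraph (Fin 4)).IsMinorOf G := by
  obtain ⟨a, ha, w, hw, haw⟩ := h.exists_adj_mem_tail hmin hdeg
  obtain ⟨z, hz, w', hw', hzw'⟩ := h.reverse.exists_adj_mem_tail (by simpa using hmin) hdeg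
  obtain ⟨hch, hnd, -, hlen, a', ha', c, hc, hac⟩ := h
  obtain rfl := Option.mem_unique ha ha'
  obtain ⟨A, rfl⟩ : ∃ A', A = a :: A' ++ [z] := by
    obtain ⟨B, rfl⟩ := List.getLast?_eq_some_iff.1 (by simpa using hz)
    match B, hlen, ha with
    | _ :: A', _, rfl => exact ⟨A', rfl⟩
  obtain ⟨C, rfl⟩ := List.head?_eq_some_iff.1 hc
  obtain ⟨d, C, rfl⟩ := List.exists_cons_of_ne_nil (List.ne_nil_of_mem hw)
  exact completeGraph_four_isMinorOf_of_isChain (by simpa using hch) (by simpa using hnd) hac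
    hw haw hw' hzw'

theorem exists_isChain_nodup_forall_length_le [Finite V] (G : SimpleGraph V) :
    ∃ l : List V, l.IsChain G.Adj ∧ l.Nodup ∧
      ∀ l' : List V, l'.IsChain G.Adj → l'.Nodup → l'.length ≤ l.length := by
  have := Fintype.ofFinite V
  have hfin : {l : List V | l.IsChain G.Adj ∧ l.Nodup}.Finite :=
    (List.finite_length_le V (Fintype.card V)).subset fun l hl => hl.2.length_le_card
  obtain ⟨l, ⟨hch, hnd⟩, hmax⟩ := Set.exists_max_image _ List.length hfin ⟨[], by simp⟩
  exact ⟨l, hch, hnd, fun l' hch' hnd' => hmax l' ⟨hch', hnd'⟩⟩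

theorem exists_isLasso [Finite V] [Nonempty V] (hdeg : ∀ v, 3 ≤ (G.neighborSet v).encard) :
    ∃ A C, IsLasso G A C := by
  obtain ⟨l, hch, hnd, hmax⟩ := exists_isChain_nodup_forall_length_le G
  obtain ⟨u⟩ := ‹Nonempty V›
  obtain ⟨v, huv : G.Adj u v, -, -⟩ := exists_mem_ne_ne_of_three_le_encard (hdeg u) u u
  obtain ⟨a, b, l, rfl⟩ : ∃ a b l', l = a :: b :: l' := by
    match l, hmax [u, v] (by simpa using huv) (by simpa using huv.ne) with
    | a :: b :: l', _ => exact ⟨a, b, l', rfl⟩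
  obtain ⟨w, haw, hwb, -⟩ := exists_mem_ne_ne_of_three_le_encard (hdeg a) b b
  have hw : w ∈ l := by
    by_contra hw
    have := hmax (w :: a :: b :: l) (List.isChain_cons_cons.2 ⟨haw.symm, hch⟩)
      (List.nodup_cons.2 ⟨by simp [hw, hwb, haw.ne'], hnd⟩)
    simp at this
  obtain ⟨X, Y, rfl⟩ := List.append_of_mem hw
  exact ⟨a :: b :: X, w :: Y, by simpa using hch, by simpa using hnd, by simpa using hmax,
    by simp, a, by simp, w, by simp, haw⟩

theorem completeGraph_four_isMinorOf_of_three_le_encard [Finite V] [Nonempty V]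
    (hdeg : ∀ v, 3 ≤ (G.neighborSet v).encard) : (completeGraph (Fin 4)).IsMinorOf G := by
  obtain ⟨A₀, C₀, h₀⟩ := exists_isLasso hdeg
  obtain ⟨⟨A, C⟩, h, hmin⟩ := exists_minimalFor_of_wellFoundedLT
    (fun p : List V × List V => IsLasso G p.1 p.2) (fun p => p.1.length) ⟨(A₀, C₀), h₀⟩
  refine h.completeGraph_four_isMinorOf (fun A' C' h' => ?_) hdeg
  exact (le_total _ _).elim id fun hle => hmin (j := (A', C')) h' hle

/-! ### Suppressing vertices of degree two -/

theorem exists_eq_pair_of_encard_eq_two {α : Type*} {s : Set α} {a : α} (hs : s.encard = 2)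
    (ha : a ∈ s) : ∃ b, a ≠ b ∧ s = {a, b} := by
  obtain ⟨x, y, hxy, rfl⟩ := Set.encard_eq_two.1 hs
  obtain rfl | rfl := ha
  · exact ⟨y, hxy, rfl⟩
  · exact ⟨x, hxy.symm, Set.pair_comm x a⟩

/-- The graph obtained from `G` by suppressing the vertices of degree two, that is, by replacing
the path `a - m - b` through such a vertex `m` by the edge `a - b`. Only paths with both ends of
degree other than two are replaced. -/
def suppressed (G : SimpleGraph V) : SimpleGraph {v // (G.neighborSet v).encard ≠ 2} where
  Adj a b := G.Adj a b ∨ a ≠ b ∧ ∃ m, G.neighborSet m = {↑a, ↑b}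
  symm := ⟨fun _ _ => Or.imp Adj.symm fun ⟨hab, m, hm⟩ => ⟨hab.symm, m, by rwa [Set.pair_comm]⟩⟩
  loopless := ⟨fun _ => by simp⟩

theorem suppressed_isMinorOf (hadj : ∀ u v, G.Adj u v → (G.neighborSet u).encard = 2 →
    (G.neighborSet v).encard ≠ 2) : (suppressed G).IsMinorOf G := by
  have hcontract : ∀ v : V, ∃ a : {v // (G.neighborSet v).encard ≠ 2},
      v = a ∨ G.Adj a v ∧ (G.neighborSet v).encard = 2 := by
    intro v
    by_cases hv : (G.neighborSet v).encard = 2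
    · obtain ⟨a, b, -, hab⟩ := Set.encard_eq_two.1 hv
      have hva : G.Adj v a := hab.superset (.inl rfl)
      exact ⟨⟨a, hadj v a hva hv⟩, .inr ⟨hva.symm, hv⟩⟩
    · exact ⟨⟨v, hv⟩, .inl rfl⟩
  choose f hf using hcontract
  have hfix : ∀ a : {v // (G.neighborSet v).encard ≠ 2}, f (a : V) = a :=
    fun a => (hf a).elim (fun h => Subtype.ext h.symm) fun h => absurd h.2 a.2
  refine isMinorOf_iff_exists_isMinorModel.2 ⟨fun a => {v | f v = a}, fun a => ?_, ?_, ?_⟩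
  · refine connected_induce_of_forall_adj (u := ↑a) (hfix a) ?_
    rintro v rfl hva
    exact ((hf v).resolve_left hva).1
  · exact fun a b hab => Set.disjoint_left.2 fun v hva hvb => hab (hva.symm.trans hvb)
  · rintro a b (hab | ⟨hne, m, hm⟩)
    · exact ⟨a, hfix a, b, hfix b, hab⟩
    · have hma : G.Adj m a := hm.superset (.inl rfl)
      have hmb : G.Adj m b := hm.superset (.inr rfl)
      have hm2 : (G.neighborSet m).encard = 2 := by
        rw [hm, Set.encard_pair (Subtype.coe_ne_coe.2 hne)]
      have hfm : G.Adj m (f m) :=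
        ((hf m).resolve_left fun h => (f m).2 (h ▸ hm2)).1.symm
      rw [← mem_neighborSet, hm] at hfm
      obtain hfm | hfm := hfm
      · exact ⟨m, Subtype.ext hfm, b, hfix b, hmb⟩
      · exact ⟨a, hfix a, m, Subtype.ext hfm, hma.symm⟩

theorem encard_neighborSet_le_suppressed
    (hadj : ∀ u v, G.Adj u v → (G.neighborSet u).encard = 2 → (G.neighborSet v).encard ≠ 2)
    (htriangle : ∀ u x y, G.neighborSet u = {x, y} → ¬ G.Adj x y)
    (hsquare : ∀ u x y, x ≠ y → G.neighborSet u = {x, y} → ∀ w, G.Adj x w → G.Adj y w → w = u)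
    (v : {v // (G.neighborSet v).encard ≠ 2}) :
    (G.neighborSet v).encard ≤ ((suppressed G).neighborSet v).encard := by
  have hfarEnd : ∀ y, G.Adj v y → ∃ t, (suppressed G).Adj v t ∧
      (y = t ∨ v ≠ t ∧ G.neighborSet y = {↑v, ↑t}) := by
    intro y hvy
    by_cases hy : (G.neighborSet y).encard = 2
    · obtain ⟨t, hvt, hyt⟩ := exists_eq_pair_of_encard_eq_two hy hvy.symm
      have ht : (G.neighborSet t).encard ≠ 2 :=
        hadj y t (hyt.superset (.inr rfl)) hy
      have hne : v ≠ ⟨t, ht⟩ := fun h => hvt (congrArg Subtype.val h)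
      exact ⟨⟨t, ht⟩, .inr ⟨hne, y, hyt⟩, .inr ⟨hne, hyt⟩⟩
    · exact ⟨⟨y, hy⟩, .inl hvy, .inl rfl⟩
  have : Nonempty {v // (G.neighborSet v).encard ≠ 2} := ⟨v⟩
  choose! f hf hfy using hfarEnd
  refine Set.encard_le_encard_of_injOn (f := f) hf fun y hy y' hy' heq => ?_
  obtain hyf | ⟨hne, hN⟩ := hfy y hy <;> obtain hyf' | ⟨-, hN'⟩ := hfy y' hy'
  · rw [hyf, hyf', heq]
  · exact absurd (by rwa [mem_neighborSet, hyf, heq] at hy) (htriangle y' v (f y') hN')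
  · exact absurd (by rwa [mem_neighborSet, hyf', ← heq] at hy') (htriangle y v (f y) hN)
  · refine (hsquare y v (f y) (Subtype.coe_ne_coe.2 hne) hN y' hy' ?_).symm
    rw [G.adj_comm, heq, ← mem_neighborSet, hN']
    exact .inr rfl

theorem exists_neighborSet_eq_pair [Finite V] [Nonempty V] (hG : G.IsK4MinorFree)
    (hdeg : ∀ v, 2 ≤ (G.neighborSet v).encard) :
    ∃ u x y, x ≠ y ∧ G.neighborSet u = {x, y} ∧
      (G.Adj x y ∨ (∃ w, w ≠ u ∧ G.Adj x w ∧ G.Adj y w) ∨ (G.neighborSet x).encard = 2) := by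
  by_contra! hcon
  have hadj : ∀ u v, G.Adj u v → (G.neighborSet u).encard = 2 → (G.neighborSet v).encard ≠ 2 := by
    intro u v huv hu
    obtain ⟨w, hvw, hN⟩ := exists_eq_pair_of_encard_eq_two hu huv
    exact (hcon u v w hvw hN).2.2
  have htriangle : ∀ u x y, G.neighborSet u = {x, y} → ¬ G.Adj x y :=
    fun u x y hN hxy => (hcon u x y hxy.ne hN).1 hxy
  have hsquare : ∀ u x y, x ≠ y → G.neighborSet u = {x, y} →
      ∀ w, G.Adj x w → G.Adj y w → w = u :=
    fun u x y hxy hN w hxw hyw => by_contra fun hwu => (hcon u x y hxy hN).2.1 w hwu hxw hyw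
  have : Nonempty {v // (G.neighborSet v).encard ≠ 2} := by
    obtain ⟨u⟩ := ‹Nonempty V›
    by_cases hu : (G.neighborSet u).encard = 2
    · obtain ⟨v, w, -, hN⟩ := Set.encard_eq_two.1 hu
      exact ⟨v, hadj u v (hN.superset (.inl rfl)) hu⟩
    · exact ⟨u, hu⟩
  have hthree : ∀ v, 3 ≤ ((suppressed G).neighborSet v).encard := fun v => by
    refine le_trans ?_ (encard_neighborSet_le_suppressed hadj htriangle hsquare v)
    exact Order.add_one_le_of_lt ((hdeg v).lt_of_ne v.2.symm)
  exact hG <| isMinorOf_trans (completeGraph_four_isMinorOf_of_three_le_encard hthree)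
    (suppressed_isMinorOf hadj)

/-! ### Colorings of the exact square -/

theorem exactSquare_adj {u v : V} :
    G.exactSquare.Adj u v ↔ u ≠ v ∧ ¬ G.Adj u v ∧ (G.commonNeighbors u v).Nonempty := by
  rw [← edist_eq_two_iff]
  exact ENat.toNat_eq_iff two_ne_zero

theorem colorable_of_encard_neighborSet_le {T : Set V} (hT : T.Finite) {n : ℕ}
    (hdeg : ∀ u ∈ T, (G.neighborSet u).encard ≤ n)
    (hcol : (G.induce Tᶜ).Colorable (n + 1)) : G.Colorable (n + 1) := by
  classical
  obtain ⟨c, hc⟩ : ∃ c : V → Fin (n + 1), ∀ a ∉ T, ∀ b ∉ T, G.Adj a b → c a ≠ c b := by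
    obtain ⟨c⟩ := hcol
    exact ⟨fun v => if hv : v ∈ T then 0 else c ⟨v, hv⟩, fun a ha b hb hab => by
      simpa only [dif_neg ha, dif_neg hb] using c.valid (v := ⟨a, ha⟩) (w := ⟨b, hb⟩) hab⟩
  clear hcol
  induction T, hT using Set.Finite.induction_on generalizing c with
  | empty => exact ⟨Coloring.mk c fun {a b} hab => hc a id b id hab⟩
  | @insert u T _ _ ih =>
    obtain ⟨k, hk⟩ : ∃ k, k ∉ c '' G.neighborSet u := by
      refine (Set.ne_univ_iff_exists_notMem _).1 fun h => ?_
      have := (Set.encard_image_le c _).trans (hdeg u (Set.mem_insert u T))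
      rw [h, Set.encard_univ, ENat.card_eq_coe_fintype_card, Fintype.card_fin] at this
      exact absurd (Nat.cast_le.1 this) (Nat.not_succ_le_self n)
    have hku : ∀ w, G.Adj u w → c w ≠ k := fun w hw h => hk ⟨w, hw, h⟩
    refine ih (fun v hv => hdeg v (.inr hv)) (Function.update c u k) fun a ha b hb hab => ?_
    obtain rfl | hau := eq_or_ne a u
    · simpa [Function.update_of_ne hab.ne'] using (hku b hab).symm
    · obtain rfl | hbu := eq_or_ne b u
      · simpa [Function.update_of_ne hau] using hku a hab.symm
      · simpa [Function.update_of_ne hau, Function.update_of_ne hbu] using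
          hc a (by simp [hau, ha]) b (by simp [hbu, hb]) hab

/-- A set `T` of vertices whose deletion reduces the problem of coloring the exact square of `G`
with `n + 1` colors: the vertices of `T` have few vertices at distance two, hence can be colored
last, and the pairs at distance two outside `T` remain so after the deletion of `T`. -/
structure IsReducible (G : SimpleGraph V) (n : ℕ) (T : Set V) : Prop where
  encard_le : ∀ u ∈ T, (G.exactSquare.neighborSet u).encard ≤ n
  exists_mem_commonNeighbors : ∀ a ∉ T, ∀ b ∉ T, G.exactSquare.Adj a b →
    ∃ m ∉ T, m ∈ G.commonNeighbors a b

theorem IsReducible.colorable_exactSquare {T : Set V} {n : ℕ} (h : IsReducible G n T)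
    (hT : T.Finite) (hcol : (G.induce Tᶜ).exactSquare.Colorable (n + 1)) :
    G.exactSquare.Colorable (n + 1) := by
  refine colorable_of_encard_neighborSet_le hT h.encard_le (hcol.mono_left ?_)
  rintro ⟨a, ha⟩ ⟨b, hb⟩ hab
  obtain ⟨m, hm, hma, hmb⟩ := h.exists_mem_commonNeighbors a ha b hb hab
  obtain ⟨hne, hnadj, -⟩ := exactSquare_adj.1 hab
  exact exactSquare_adj.2 ⟨fun h => hne (congrArg Subtype.val h), hnadj, ⟨m, hm⟩, hma, hmb⟩

theorem isReducible_singleton {n : ℕ} {u : V} (hle : (G.exactSquare.neighborSet u).encard ≤ n)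
    (hu : ∀ a b, G.Adj u a → G.Adj u b → G.exactSquare.Adj a b →
      ∃ m ≠ u, m ∈ G.commonNeighbors a b) : IsReducible G n {u} where
  encard_le := by rintro _ rfl; exact hle
  exists_mem_commonNeighbors a _ b _ hab := by
    obtain ⟨-, -, m, hma, hmb⟩ := exactSquare_adj.1 hab
    obtain rfl | hmu := eq_or_ne m u
    · exact hu a b hma.symm hmb.symm hab
    · exact ⟨m, hmu, hma, hmb⟩

theorem exactSquare_neighborSet_subset {u x y : V} (hN : G.neighborSet u ⊆ {x, y}) :
    G.exactSquare.neighborSet u ⊆ (G.neighborSet x \ {u}) ∪ (G.neighborSet y \ {u}) := by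
  intro w hw
  obtain ⟨hne, -, m, hum, hwm⟩ := exactSquare_adj.1 hw
  obtain rfl | rfl := hN hum
  · exact .inl ⟨hwm.symm, hne.symm⟩
  · exact .inr ⟨hwm.symm, hne.symm⟩

theorem encard_sdiff_singleton_le {α : Type*} {s : Set α} {a : α} {k : ℕ∞}
    (hs : s.encard ≤ k + 1) (ha : a ∈ s) : (s \ {a}).encard ≤ k := by
  rwa [← Set.encard_sdiff_singleton_add_one ha, ENat.add_le_add_iff_right ENat.one_ne_top] at hs

theorem isReducible_of_encard_le_one {u : V} (hG : G.IsSubcubic)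
    (hu : (G.neighborSet u).encard ≤ 1) : IsReducible G 3 {u} := by
  have hsub : (G.neighborSet u).Subsingleton := Set.encard_le_one_iff_subsingleton.1 hu
  refine isReducible_singleton ?_ fun a b ha hb hab => absurd (hsub ha hb) hab.ne
  obtain ⟨x, hx⟩ : ∃ x, G.neighborSet u ⊆ {x} := by
    obtain h | ⟨x, hx⟩ := hsub.eq_empty_or_singleton
    exacts [⟨u, h ▸ Set.empty_subset _⟩, ⟨x, hx.subset⟩]
  have hsub2 : G.exactSquare.neighborSet u ⊆ G.neighborSet x :=
    (exactSquare_neighborSet_subset (hx.trans (Set.subset_insert x {x}))).trans <|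
      Set.union_subset Set.sdiff_subset Set.sdiff_subset
  exact (Set.encard_le_encard hsub2).trans (hG x)

theorem isReducible_of_triangle {u x y : V} (hG : G.IsSubcubic) (hN : G.neighborSet u = {x, y})
    (hxy : G.Adj x y) : IsReducible G 3 {u} := by
  have hux : G.Adj u x := hN.superset (.inl rfl)
  have huy : G.Adj u y := hN.superset (.inr rfl)
  refine isReducible_singleton ?_ fun a b ha hb hab => ?_
  · have hsub : G.exactSquare.neighborSet u ⊆
        (G.neighborSet x \ {u}) \ {y} ∪ (G.neighborSet y \ {u}) \ {x} := by
      intro w hw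
      obtain ⟨-, hnadj, -⟩ := exactSquare_adj.1 hw
      have hwx : w ≠ x := by rintro rfl; exact hnadj hux
      have hwy : w ≠ y := by rintro rfl; exact hnadj huy
      exact (exactSquare_neighborSet_subset hN.subset hw).imp (⟨·, hwy⟩) (⟨·, hwx⟩)
    calc (G.exactSquare.neighborSet u).encard
      _ ≤ _ := (Set.encard_le_encard hsub).trans (Set.encard_union_le _ _)
      _ ≤ 1 + 1 := by
        gcongr
        · exact encard_sdiff_singleton_le (encard_sdiff_singleton_le (hG x) hux.symm)
            ⟨hxy, huy.ne'⟩
        · exact encard_sdiff_singleton_le (encard_sdiff_singleton_le (hG y) huy.symm)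
            ⟨hxy.symm, hux.ne'⟩
      _ ≤ 3 := by decide
  · obtain ⟨hne, hnadj, -⟩ := exactSquare_adj.1 hab
    rw [← mem_neighborSet, hN] at ha hb
    obtain rfl | rfl := ha <;> obtain rfl | rfl := hb
    exacts [absurd rfl hne, absurd hxy hnadj, absurd hxy.symm hnadj, absurd rfl hne]

theorem isReducible_of_square {u w x y : V} (hG : G.IsSubcubic) (hN : G.neighborSet u = {x, y})
    (hwu : w ≠ u) (hxw : G.Adj x w) (hyw : G.Adj y w) : IsReducible G 3 {u} := by
  have hux : G.Adj u x := hN.superset (.inl rfl)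
  have huy : G.Adj u y := hN.superset (.inr rfl)
  refine isReducible_singleton ?_ fun a b ha hb hab => ⟨w, hwu, ?_⟩
  · have hsub : G.exactSquare.neighborSet u ⊆
        {w} ∪ ((G.neighborSet x \ {u}) \ {w} ∪ (G.neighborSet y \ {u}) \ {w}) := by
      intro v hv
      obtain rfl | hvw := eq_or_ne v w
      · exact .inl rfl
      · exact .inr <| (exactSquare_neighborSet_subset hN.subset hv).imp (⟨·, hvw⟩) (⟨·, hvw⟩)
    calc (G.exactSquare.neighborSet u).encard
      _ ≤ _ := (Set.encard_le_encard hsub).trans <| (Set.encard_union_le _ _).trans <|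
        add_le_add_right (Set.encard_union_le _ _) _
      _ ≤ 1 + (1 + 1) := by
        gcongr
        · exact (Set.encard_singleton w).le
        · exact encard_sdiff_singleton_le (encard_sdiff_singleton_le (hG x) hux.symm) ⟨hxw, hwu⟩
        · exact encard_sdiff_singleton_le (encard_sdiff_singleton_le (hG y) huy.symm) ⟨hyw, hwu⟩
      _ ≤ 3 := by decide
  · rw [← mem_neighborSet, hN] at ha hb
    obtain rfl | rfl := ha <;> obtain rfl | rfl := hb
    exacts [absurd rfl hab.ne, ⟨hxw, hyw⟩, ⟨hyw, hxw⟩, absurd rfl hab.ne]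

theorem encard_exactSquare_neighborSet_le_three {u x y : V} (hG : G.IsSubcubic)
    (hN : G.neighborSet u = {x, y}) (hx : (G.neighborSet x).encard = 2) :
    (G.exactSquare.neighborSet u).encard ≤ 3 := calc
  (G.exactSquare.neighborSet u).encard
  _ ≤ _ := (Set.encard_le_encard (exactSquare_neighborSet_subset hN.subset)).trans
    (Set.encard_union_le _ _)
  _ ≤ 1 + 2 := by
    have hux : G.Adj u x := hN.superset (.inl rfl)
    have huy : G.Adj u y := hN.superset (.inr rfl)
    gcongr
    · exact encard_sdiff_singleton_le hx.le hux.symm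
    · exact encard_sdiff_singleton_le (hG y) huy.symm
  _ = 3 := rfl

theorem isReducible_of_adj {u x : V} (hG : G.IsSubcubic) (hux : G.Adj u x)
    (hu : (G.neighborSet u).encard = 2) (hx : (G.neighborSet x).encard = 2) :
    IsReducible G 3 {u, x} := by
  obtain ⟨y, -, hNu⟩ := exists_eq_pair_of_encard_eq_two hu hux
  obtain ⟨z, -, hNx⟩ := exists_eq_pair_of_encard_eq_two hx hux.symm
  constructor
  · rintro _ (rfl | rfl)
    · exact encard_exactSquare_neighborSet_le_three hG hNu hx
    · exact encard_exactSquare_neighborSet_le_three hG hNx hu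
  · intro a ha b hb hab
    obtain ⟨hne, -, m, hma, hmb⟩ := exactSquare_adj.1 hab
    refine ⟨m, ?_, hma, hmb⟩
    rintro (rfl | rfl)
    · have hay : a = y := (hNu.subset hma.symm).resolve_left fun h => ha (.inr h)
      have hby : b = y := (hNu.subset hmb.symm).resolve_left fun h => hb (.inr h)
      exact hne (hay.trans hby.symm)
    · have haz : a = z := (hNx.subset hma.symm).resolve_left fun h => ha (.inl h)
      have hbz : b = z := (hNx.subset hmb.symm).resolve_left fun h => hb (.inl h)
      exact hne (haz.trans hbz.symm)

theorem exists_isReducible [Finite V] [Nonempty V] (hs : G.IsSubcubic) (hK : G.IsK4MinorFree) :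
    ∃ T : Set V, T.Nonempty ∧ IsReducible G 3 T := by
  by_cases hdeg : ∀ v, 2 ≤ (G.neighborSet v).encard
  · obtain ⟨u, x, y, hxy, hN, hadj | ⟨w, hwu, hxw, hyw⟩ | hx⟩ := exists_neighborSet_eq_pair hK hdeg
    · exact ⟨{u}, ⟨u, rfl⟩, isReducible_of_triangle hs hN hadj⟩
    · exact ⟨{u}, ⟨u, rfl⟩, isReducible_of_square hs hN hwu hxw hyw⟩
    · have hux : G.Adj u x := hN.superset (.inl rfl)
      exact ⟨{u, x}, ⟨u, .inl rfl⟩, isReducible_of_adj hs hux (hN ▸ Set.encard_pair hxy) hx⟩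
  · obtain ⟨u, hu⟩ := not_forall.1 hdeg
    exact ⟨{u}, ⟨u, rfl⟩,
      isReducible_of_encard_le_one hs (Order.le_of_lt_add_one (not_le.1 hu))⟩

theorem isSubcubic_of_isContained (hG : G.IsSubcubic) (h : H ⊑ G) : H.IsSubcubic := by
  obtain ⟨f⟩ := h
  exact fun v => (Set.encard_le_encard_of_injOn (f := f) (fun w hw => f.toHom.map_adj hw)
    f.injective.injOn).trans (hG (f v))

theorem colorable_exactSquare [Finite V] (hs : G.IsSubcubic) (hK : G.IsK4MinorFree) :
    G.exactSquare.Colorable 4 := by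
  induction hn : Nat.card V using Nat.strong_induction_on generalizing V with
  | _ n ih =>
  subst hn
  cases isEmpty_or_nonempty V
  · exact .of_isEmpty _
  obtain ⟨T, hT, hred⟩ := exists_isReducible hs hK
  have hcard : Nat.card ↥Tᶜ < Nat.card V := Set.ncard_lt_card (Set.compl_ne_univ.2 hT)
  have hcopy : G.induce Tᶜ ⊑ G := ⟨Copy.induce G Tᶜ⟩
  exact hred.colorable_exactSquare T.toFinite
    (ih _ hcard (isSubcubic_of_isContained hs hcopy) (isK4MinorFree_of_isContained hK hcopy) rfl)

theorem exactSquareChromaticNumber_eq_four [Finite V] (hs : G.IsSubcubic) (hK : G.IsK4MinorFree)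
    (h : ¬ G.exactSquare.Colorable 3) : G.exactSquareChromaticNumber = 4 := by
  refine le_antisymm (chromaticNumber_le_iff_colorable.2 (colorable_exactSquare hs hK)) ?_
  by_contra! hlt
  change G.exactSquare.chromaticNumber < (3 : ℕ) + 1 at hlt
  exact h (chromaticNumber_le_iff_colorable.1 (Order.le_of_lt_add_one hlt))

/-! ### Elimination orders -/

theorem connected_induce_image {S : Set V} {φ : V → W} (hS : (G.induce S).Connected)
    (hφ : ∀ a ∈ S, ∀ b ∈ S, G.Adj a b → φ a = φ b ∨ H.Adj (φ a) (φ b)) :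
    (H.induce (φ '' S)).Connected := by
  have hadj : ∀ a b : S, (G.induce S).Adj a b → (H.induce (φ '' S)).Reachable
      (⟨φ a, Set.mem_image_of_mem φ a.2⟩) ⟨φ b, Set.mem_image_of_mem φ b.2⟩ := by
    intro a b hab
    obtain heq | hadj := hφ a a.2 b b.2 hab
    · simp only [heq, Reachable.refl]
    · exact Adj.reachable (G := H.induce (φ '' S)) hadj
  obtain ⟨a, ha⟩ := Set.nonempty_coe_sort.1 hS.nonempty
  refine connected_iff_exists_forall_reachable _ |>.2 ⟨⟨φ a, Set.mem_image_of_mem φ ha⟩, ?_⟩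
  rintro ⟨_, b, hb, rfl⟩
  exact reachable_map_of_forall_adj hadj (hS.preconnected ⟨a, ha⟩ ⟨b, hb⟩)

theorem IsMinorModel.exists_adj_mem_branchSet {B : W → Set V} (hB : IsMinorModel ⊤ G B) {v : V}
    {i : W} (hv : v ∈ B i)
    (hcard : {w | G.Adj v w ∧ ∃ j, w ∈ B j}.encard + 1 < ENat.card W) : ∃ n ∈ B i, G.Adj v n := by
  by_contra! hno
  have hBi : ∀ x ∈ B i, x = v := by
    by_contra! ⟨x, hx, hxv⟩
    have : Nontrivial (B i) := ⟨⟨x, hx⟩, ⟨v, hv⟩, fun h => hxv (congrArg Subtype.val h)⟩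
    obtain ⟨⟨n, hn⟩, hvn⟩ := (hB.connected i).preconnected.exists_adj_of_nontrivial ⟨v, hv⟩
    exact hno n hn hvn
  have hneighbor : ∀ j ∈ ({i}ᶜ : Set W), ∃ y ∈ B j, G.Adj v y := by
    intro j hj
    obtain ⟨x, hx, y, hy, hxy⟩ := hB.exists_adj i j (Ne.symm hj)
    exact ⟨y, hy, hBi x hx ▸ hxy⟩
  have : Nonempty V := ⟨v⟩
  choose! y hyB hvy using hneighbor
  refine hcard.not_ge ?_
  calc ENat.card W = ({i}ᶜ : Set W).encard + 1 := by
        rw [← Set.encard_univ, Set.compl_eq_univ_sdiff,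
          Set.encard_sdiff_singleton_add_one (Set.mem_univ i)]
    _ ≤ _ := by
      gcongr
      refine Set.encard_le_encard_of_injOn (f := y) (fun j hj => ⟨hvy j hj, j, hyB j hj⟩) ?_
      intro j hj j' hj' heq
      by_contra hne
      exact (hB.disjoint hne).ne_of_mem (hyB j hj) (hyB j' hj') heq

theorem IsMinorModel.exists_subset_sdiff_singleton {B : W → Set V} (hB : IsMinorModel ⊤ G B)
    (v : V) (hclique : G.IsClique {w | G.Adj v w ∧ ∃ j, w ∈ B j})
    (hcard : {w | G.Adj v w ∧ ∃ j, w ∈ B j}.encard + 1 < ENat.card W) :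
    ∃ B', IsMinorModel (⊤ : SimpleGraph W) G B' ∧ ∀ j, B' j ⊆ B j \ {v} := by
  classical
  by_cases hv : ∃ i, v ∈ B i
  swap
  · exact ⟨B, hB, fun j => Set.subset_sdiff_singleton subset_rfl fun hvj => hv ⟨j, hvj⟩⟩
  obtain ⟨i, hvi⟩ := hv
  obtain ⟨n, hni, hvn⟩ := hB.exists_adj_mem_branchSet hvi hcard
  -- contract the edge between `v` and `n`
  have hretract : ∀ a b j k, a ∈ B j → b ∈ B k → G.Adj a b →
      Function.update id v n a = Function.update id v n b ∨
        G.Adj (Function.update id v n a) (Function.update id v n b) := by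
    intro a b j k ha hb hab
    obtain rfl | hav := eq_or_ne a v
    · simpa [Function.update_of_ne hab.ne', or_iff_not_imp_left] using
        hclique ⟨hvn, i, hni⟩ ⟨hab, k, hb⟩
    · obtain rfl | hbv := eq_or_ne b v
      · simpa [Function.update_of_ne hav, or_iff_not_imp_left] using
          hclique ⟨hab.symm, j, ha⟩ ⟨hvn, i, hni⟩
      · simpa [Function.update_of_ne hav, Function.update_of_ne hbv] using .inr hab
  have hmem : ∀ j, ∀ a ∈ B j, Function.update id v n a ∈ B j \ {v} := by
    intro j a ha
    obtain rfl | hav := eq_or_ne a v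
    · obtain rfl : i = j := by_contra fun hij => (hB.disjoint hij).ne_of_mem hvi ha rfl
      simpa using ⟨hni, hvn.ne'⟩
    · simpa [Function.update_of_ne hav] using ⟨ha, hav⟩
  refine ⟨fun j => Function.update id v n '' B j, ⟨fun j => ?_, fun j k hjk => ?_,
    fun j k hjk => ?_⟩, fun j => Set.image_subset_iff.2 (hmem j)⟩
  · exact connected_induce_image (hB.connected j) fun a ha b hb => hretract a b j j ha hb
  · exact (hB.disjoint hjk).mono (Set.image_subset_iff.2 fun a ha => (hmem j a ha).1)
      (Set.image_subset_iff.2 fun a ha => (hmem k a ha).1)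
  · obtain ⟨a, ha, b, hb, hab⟩ := hB.exists_adj j k hjk
    refine ⟨_, Set.mem_image_of_mem _ ha, _, Set.mem_image_of_mem _ hb,
      (hretract a b j k ha hb hab).resolve_left ?_⟩
    exact (hB.disjoint hjk.ne).ne_of_mem (hmem j a ha).1 (hmem k b hb).1

theorem not_isMinorOf_of_isClique [Finite V] {ι : Type*} [LinearOrder ι] {r : V → ι}
    (hr : r.Injective) (hclique : ∀ v, G.IsClique {w | G.Adj v w ∧ r v < r w}) {k : ℕ∞}
    (hcard : ∀ v, {w | G.Adj v w ∧ r v < r w}.encard ≤ k) (hk : k + 1 < ENat.card W) :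
    ¬ (⊤ : SimpleGraph W).IsMinorOf G := by
  suffices ∀ (S : Set V) (B : W → Set V), IsMinorModel ⊤ G B → ¬ ∀ i, B i ⊆ S by
    rw [isMinorOf_iff_exists_isMinorModel]
    exact fun ⟨B, hB⟩ => this Set.univ B hB fun i => Set.subset_univ _
  intro S
  induction S using WellFoundedLT.induction with
  | _ S ih =>
  intro B hB hBS
  obtain ⟨i⟩ : Nonempty W := ENat.card_ne_zero_iff_nonempty _ |>.1 hk.ne_bot
  obtain ⟨x, hx⟩ := Set.nonempty_coe_sort.1 (hB.connected i).nonempty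
  obtain ⟨v, hvS, hmin⟩ := Set.exists_min_image S r S.toFinite ⟨x, hBS i hx⟩
  have hlater : {w | G.Adj v w ∧ ∃ j, w ∈ B j} ⊆ {w | G.Adj v w ∧ r v < r w} :=
    fun w ⟨hvw, j, hw⟩ => ⟨hvw, (hmin w (hBS j hw)).lt_of_ne (hr.ne hvw.ne)⟩
  obtain ⟨B', hB', hsub⟩ := hB.exists_subset_sdiff_singleton v ((hclique v).subset hlater)
    ((add_le_add_left ((Set.encard_le_encard hlater).trans (hcard v)) 1).trans_lt hk)
  exact ih (S \ {v}) (Set.sdiff_singleton_ssubset.2 hvS) B' hB' fun j =>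
    (hsub j).trans (Set.sdiff_subset_sdiff_left (hBS j))

/-! ### The two extremal graphs -/

theorem six_le_egirth_of_isBipartite (hG : G.IsBipartite)
    (h : ∀ u v, u ≠ v → (G.commonNeighbors u v).Subsingleton) : 6 ≤ G.egirth := by
  rw [le_egirth]
  intro u p hp
  have hthree := hp.three_le_length
  have hfour : p.length ≠ 4 := by
    intro hlength
    have hnodup := hp.support_nodup
    match p, hlength with
    | .cons (v := a) h₁ (.cons (v := b) h₂ (.cons (v := c) h₃ (.cons h₄ .nil))), _ =>
      simp only [Walk.support_cons, Walk.support_nil, List.tail_cons, List.nodup_cons,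
        List.mem_cons, not_or] at hnodup
      have hub : u ≠ b := Ne.symm hnodup.2.1.2.1
      have hac : a ≠ c := hnodup.1.2.1
      exact hac (h u b hub ⟨h₁, h₂.symm⟩ ⟨h₄.symm, h₃⟩)
  obtain ⟨k, hk⟩ := two_colorable_iff_forall_loop_even.1 hG u p
  have hsix : 6 ≤ p.length := by omega
  exact_mod_cast hsix

/-- The graph whose edges are the pairs of distinct vertices listed in `l`. -/
def ofEdgeList (l : List (V × V)) : SimpleGraph V := fromRel fun a b => (a, b) ∈ l

instance [DecidableEq V] (l : List (V × V)) : DecidableRel (ofEdgeList l).Adj :=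
  fun a b => inferInstanceAs (Decidable (a ≠ b ∧ ((a, b) ∈ l ∨ (b, a) ∈ l)))

instance [Fintype V] [DecidableEq V] [DecidableRel G.Adj] : DecidableRel G.exactSquare.Adj :=
  fun u v => decidable_of_iff (u ≠ v ∧ ¬ G.Adj u v ∧ ∃ w, G.Adj u w ∧ G.Adj v w)
    exactSquare_adj.symm

theorem ofEdgeList_mono {l l' : List (V × V)} (h : l ⊆ l') : ofEdgeList l ≤ ofEdgeList l' :=
  fun _ _ ⟨hne, hmem⟩ => ⟨hne, hmem.imp (@h _) (@h _)⟩

theorem isSubcubic_of_degree_le [Fintype V] [DecidableRel G.Adj] (h : ∀ v, G.degree v ≤ 3) :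
    G.IsSubcubic := by
  intro v
  rw [← coe_neighborFinset, Set.encard_coe_eq_coe_finsetCard, card_neighborFinset_eq_degree]
  exact_mod_cast h v

theorem isK4MinorFree_of_perfectElimination [Fintype V] [DecidableRel G.Adj] {r : V → ℕ}
    (hr : r.Injective)
    (hclique : ∀ v a, G.Adj v a → r v < r a → ∀ b, G.Adj v b → r v < r b → a ≠ b → G.Adj a b)
    (hcard : ∀ v, (Finset.univ.filter fun w => G.Adj v w ∧ r v < r w).card ≤ 2) :
    G.IsK4MinorFree := by
  refine not_isMinorOf_of_isClique hr
    (fun v a ha b hb hab => hclique v a ha.1 ha.2 b hb.1 hb.2 hab) (k := 2) (fun v => ?_) ?_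
  · rw [← Finset.coe_filter_univ, Set.encard_coe_eq_coe_finsetCard]
    exact_mod_cast hcard v
  · rw [ENat.card_eq_coe_fintype_card, Fintype.card_fin]
    exact Nat.cast_lt.2 (show 2 + 1 < 4 by decide)

theorem isK4MinorFree_ofEdgeList_of_append {l : List (V × V)} (fill : List (V × V))
    (h : (ofEdgeList (l ++ fill)).IsK4MinorFree) :
    (ofEdgeList l).IsK4MinorFree :=
  isK4MinorFree_of_isContained h (.of_le (ofEdgeList_mono (List.subset_append_left l fill)))

/-- The theta graph with two vertices `0` and `3` of degree three joined by three internally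
disjoint paths of length three. It is the bipartite example of girth six. -/
def thetaGraph : SimpleGraph (Fin 8) :=
  ofEdgeList [(0, 1), (1, 2), (2, 3), (0, 4), (4, 5), (5, 3), (0, 6), (6, 7), (7, 3)]

instance : DecidableRel thetaGraph.Adj := inferInstanceAs (DecidableRel (ofEdgeList _).Adj)

theorem isSubcubic_thetaGraph : thetaGraph.IsSubcubic := isSubcubic_of_degree_le (by decide)

theorem isBipartite_thetaGraph : thetaGraph.IsBipartite :=
  ⟨Coloring.mk ![0, 1, 0, 1, 1, 0, 1, 0] (by decide)⟩

theorem six_le_egirth_thetaGraph : 6 ≤ thetaGraph.egirth :=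
  six_le_egirth_of_isBipartite isBipartite_thetaGraph fun u v huv a ha b hb =>
    (by decide : ∀ u v, u ≠ v → ∀ a, thetaGraph.Adj u a → thetaGraph.Adj v a →
      ∀ b, thetaGraph.Adj u b → thetaGraph.Adj v b → a = b) u v huv a ha.1 ha.2 b hb.1 hb.2

theorem isK4MinorFree_thetaGraph : thetaGraph.IsK4MinorFree :=
  isK4MinorFree_ofEdgeList_of_append [(0, 2), (0, 3), (0, 5), (0, 7)]
    (isK4MinorFree_of_perfectElimination (r := ![6, 0, 1, 7, 2, 3, 4, 5])
      (by decide) (by decide) (by decide))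

theorem not_colorable_exactSquare_thetaGraph : ¬ thetaGraph.exactSquare.Colorable 3 := by
  have hclique : thetaGraph.exactSquare.IsClique ({0, 2, 5, 7} : Finset (Fin 8)) := by decide
  exact fun hcol => absurd (hclique.card_le_of_colorable hcol) (by decide)

/-- The outerplanar example: the cycle on `0, …, 19` with five chords. Its inner faces are a
heptagon, two quadrilaterals and three pentagons; the pentagon on `9, …, 13` shares an edge with
the heptagon, and each of the other two is joined to it through one of the quadrilaterals. -/
def pentagonGraph : SimpleGraph (Fin 20) :=
  ofEdgeList [(0, 1), (1, 2), (2, 3), (3, 4), (4, 5), (5, 6), (6, 7), (7, 8), (8, 9), (9, 10),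
    (10, 11), (11, 12), (12, 13), (13, 14), (14, 15), (15, 16), (16, 17), (17, 18), (18, 19),
    (0, 19), (2, 8), (3, 7), (9, 13), (0, 14), (15, 19)]

instance : DecidableRel pentagonGraph.Adj := inferInstanceAs (DecidableRel (ofEdgeList _).Adj)

set_option maxRecDepth 10000 in
theorem isSubcubic_pentagonGraph : pentagonGraph.IsSubcubic := isSubcubic_of_degree_le (by decide)

set_option maxRecDepth 10000 in
theorem isK4MinorFree_pentagonGraph : pentagonGraph.IsK4MinorFree :=
  -- the added edges triangulate the inner faces
  isK4MinorFree_ofEdgeList_of_append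
    [(0, 2), (0, 8), (0, 9), (0, 13), (2, 7), (3, 5), (3, 6), (9, 11), (9, 12), (14, 19), (16, 19),
      (17, 19)]
    (isK4MinorFree_of_perfectElimination
      (r := ![13, 0, 6, 4, 1, 2, 3, 5, 7, 11, 8, 9, 10, 12, 14, 15, 16, 17, 18, 19])
      (by decide) (by decide) (by decide))

theorem eq_of_ne_common_pair {a b x y : Fin 3} (hab : a ≠ b) (hxa : x ≠ a) (hxb : x ≠ b)
    (hya : y ≠ a) (hyb : y ≠ b) : x = y := by
  lia

theorem not_colorable_exactSquare_pentagonGraph : ¬ pentagonGraph.exactSquare.Colorable 3 := by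
  rintro ⟨C⟩
  have hC (u v : Fin 20) (h : pentagonGraph.exactSquare.Adj u v := by decide) : C u ≠ C v :=
    C.valid h
  have h₉₁ : C 9 ≠ C 1 := by
    have h₉₄ : C 9 = C 4 := eq_of_ne_common_pair (hC 2 7) (hC 9 2) (hC 9 7) (hC 4 2) (hC 4 7)
    have h₁₆ : C 1 = C 6 := eq_of_ne_common_pair (hC 3 8) (hC 1 3) (hC 1 8) (hC 6 3) (hC 6 8)
    simpa only [h₉₄, h₁₆] using hC 4 6
  have h₁₃₁ : C 13 ≠ C 1 := by
    have h₁₃₁₈ : C 13 = C 18 :=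
      eq_of_ne_common_pair (hC 0 15) (hC 13 0) (hC 13 15) (hC 18 0) (hC 18 15)
    have h₁₁₆ : C 1 = C 16 :=
      eq_of_ne_common_pair (hC 14 19) (hC 1 14) (hC 1 19) (hC 16 14) (hC 16 19)
    simpa only [h₁₃₁₈, h₁₁₆] using hC 18 16
  have h₁₀₁ : C 10 = C 1 :=
    eq_of_ne_common_pair (hC 8 13) (hC 10 8) (hC 10 13) (hC 1 8) h₁₃₁.symm
  have h₁₂₁ : C 12 = C 1 :=
    eq_of_ne_common_pair (hC 9 14) (hC 12 9) (hC 12 14) h₉₁.symm (hC 1 14)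
  exact absurd (h₁₀₁.trans h₁₂₁.symm) (hC 10 12)

/-! ### Outerplanarity of noncrossing chords -/

/-- The point of the parabola `y = x ^ 2` with first coordinate `x`. -/
noncomputable def parabolaPoint (x : ℝ) : EuclideanSpace ℝ (Fin 2) := !₂[x, x ^ 2]

@[simp]
theorem parabolaPoint_zero (x : ℝ) : parabolaPoint x 0 = x := rfl

@[simp]
theorem parabolaPoint_one (x : ℝ) : parabolaPoint x 1 = x ^ 2 := rfl

theorem parabolaPoint_injective : parabolaPoint.Injective :=
  fun _ _ h => congrArg (fun z => z 0) h

theorem mem_segment_parabolaPoint {a b : ℝ} (hab : a ≤ b) {z : EuclideanSpace ℝ (Fin 2)}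
    (hz : z ∈ segment ℝ (parabolaPoint a) (parabolaPoint b)) :
    z 0 ∈ Set.Icc a b ∧ z 1 = z 0 ^ 2 + (z 0 - a) * (b - z 0) := by
  rw [segment_eq_image_lineMap] at hz
  obtain ⟨t, ⟨ht0, ht1⟩, rfl⟩ := hz
  simp only [AffineMap.lineMap_apply, vsub_eq_sub, vadd_eq_add, PiLp.add_apply, PiLp.smul_apply,
    PiLp.sub_apply, parabolaPoint_zero, parabolaPoint_one, smul_eq_mul, Set.mem_Icc]
  refine ⟨⟨?_, ?_⟩, by ring⟩ <;> nlinarith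

theorem eq_parabolaPoint_of_mul_eq_zero {a b : ℝ} (hab : a ≤ b) {z : EuclideanSpace ℝ (Fin 2)}
    (hz : z ∈ segment ℝ (parabolaPoint a) (parabolaPoint b)) (h : z 0 = a ∨ z 0 = b) :
    z = parabolaPoint (z 0) := by
  obtain ⟨-, hz1⟩ := mem_segment_parabolaPoint hab hz
  ext i
  fin_cases i
  · rfl
  · change z 1 = z 0 ^ 2
    rw [hz1, add_eq_left, mul_eq_zero, sub_eq_zero, sub_eq_zero]
    exact h.imp_right Eq.symm

theorem eq_ends_of_chord_height_eq {a b c d x : ℝ} (hx : x ∈ Set.Icc a b) (hx' : x ∈ Set.Icc c d)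
    (heq : (x - a) * (b - x) = (x - c) * (d - x)) (hne : ¬ (a = c ∧ b = d))
    (hacb : ¬ (a < c ∧ c < b ∧ b < d)) (hcad : ¬ (c < a ∧ a < d ∧ d < b)) :
    (x = a ∨ x = b) ∧ (x = c ∨ x = d) := by
  obtain ⟨⟨hax, hxb⟩, hcx, hxd⟩ := hx, hx'
  by_cases hzero : (x - a) * (b - x) = 0
  · have hzero' := heq ▸ hzero
    rw [mul_eq_zero, sub_eq_zero, sub_eq_zero, eq_comm (a := b)] at hzero
    rw [mul_eq_zero, sub_eq_zero, sub_eq_zero, eq_comm (a := d)] at hzero'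
    exact ⟨hzero, hzero'⟩
  exfalso
  have hzero' := heq ▸ hzero
  simp only [mul_eq_zero, not_or] at hzero hzero'
  have ha : 0 < x - a := (sub_nonneg.2 hax).lt_of_ne' hzero.1
  have hb : 0 < b - x := (sub_nonneg.2 hxb).lt_of_ne' hzero.2
  have hc : 0 < x - c := (sub_nonneg.2 hcx).lt_of_ne' hzero'.1
  have hd : 0 < d - x := (sub_nonneg.2 hxd).lt_of_ne' hzero'.2
  -- one of the two chords is nested in the other, hence strictly lower above `x`
  obtain hac | rfl | hca := lt_trichotomy a c
  · have hdb : d ≤ b := not_lt.1 fun hbd => hacb ⟨hac, by linarith, hbd⟩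
    nlinarith
  · exact hne ⟨rfl, by linarith [mul_left_cancel₀ ha.ne' heq]⟩
  · have hbd : b ≤ d := not_lt.1 fun hdb => hcad ⟨hca, by linarith, hdb⟩
    nlinarith

/-- The segment representing an edge of a graph whose vertices `v` are placed at the points of the
parabola with first coordinate `x v`. -/
noncomputable def chord (x : V → ℝ) (e : Sym2 V) : Set (EuclideanSpace ℝ (Fin 2)) :=
  e.lift ⟨fun u v => segment ℝ (parabolaPoint (x u)) (parabolaPoint (x v)),
    fun _ _ => segment_symm _ _ _⟩

theorem exists_eq_mk_of_le (x : V → ℝ) (e : Sym2 V) : ∃ u v, x u ≤ x v ∧ e = s(u, v) := by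
  obtain ⟨u, v⟩ := e
  obtain h | h := le_total (x u) (x v)
  · exact ⟨u, v, h, rfl⟩
  · exact ⟨v, u, h, Sym2.eq_swap⟩

theorem mem_of_parabolaPoint_mem_chord {x : V → ℝ} (hx : x.Injective) {e : Sym2 V} {v : V}
    (h : parabolaPoint (x v) ∈ chord x e) : v ∈ e := by
  obtain ⟨a, b, hab, rfl⟩ := exists_eq_mk_of_le x e
  obtain ⟨-, hv⟩ := mem_segment_parabolaPoint hab h
  have hv : x v = x a ∨ x b = x v := by simpa [sub_eq_zero] using hv
  simpa only [Sym2.mem_iff] using hv.imp (@hx _ _) fun h => (hx h).symm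

/-- No two edges of `G` interleave when the vertices are placed on a line according to `x`. -/
def IsNoncrossing (G : SimpleGraph V) (x : V → ℝ) : Prop :=
  ∀ a b c d, G.Adj a b → G.Adj c d → ¬ (x a < x c ∧ x c < x b ∧ x b < x d)

theorem chord_inter_chord_subset {x : V → ℝ} (hx : x.Injective) (hG : IsNoncrossing G x)
    {e e' : Sym2 V} (he : e ∈ G.edgeSet) (he' : e' ∈ G.edgeSet) (hne : e ≠ e') :
    chord x e ∩ chord x e' ⊆ (fun v => parabolaPoint (x v)) '' {v | v ∈ e ∧ v ∈ e'} := by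
  obtain ⟨a, b, hab, rfl⟩ := exists_eq_mk_of_le x e
  obtain ⟨c, d, hcd, rfl⟩ := exists_eq_mk_of_le x e'
  rw [mem_edgeSet] at he he'
  rintro z ⟨hz, hz'⟩
  obtain ⟨hz0, hz1⟩ := mem_segment_parabolaPoint hab hz
  obtain ⟨hz0', hz1'⟩ := mem_segment_parabolaPoint hcd hz'
  obtain ⟨hends, hends'⟩ := eq_ends_of_chord_height_eq hz0 hz0' (by linarith)
    (fun h => hne (by rw [hx h.1, hx h.2])) (hG a b c d he he') (hG c d a b he' he)
  have hz := eq_parabolaPoint_of_mul_eq_zero hab hz hends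
  obtain ⟨v, hv, hzv⟩ : ∃ v, v ∈ s(a, b) ∧ z 0 = x v := by simpa using hends
  refine ⟨v, ⟨hv, ?_⟩, by rw [hz, hzv]⟩
  simpa [hzv, hx.eq_iff] using hends'

/-- The drawing of `G` with vertices on a parabola and straight edges. -/
noncomputable def parabolaDrawing {x : V → ℝ} (hx : x.Injective) (hG : IsNoncrossing G x) :
    G.PlaneDrawing where
  pt v := parabolaPoint (x v)
  arc := chord x
  pt_injective := parabolaPoint_injective.comp hx
  arc_eq_range _ _ huv :=
    ⟨.segment _ _, Path.segment_injective_of_ne (parabolaPoint_injective.ne (hx.ne huv.ne)),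
      Path.range_segment _ _⟩
  mem_of_pt_mem_arc _ _ _ := mem_of_parabolaPoint_mem_chord hx
  arc_inter_arc _ he _ he' := chord_inter_chord_subset hx hG he he'

/-- The open region of the plane below the parabola `y = x ^ 2`. -/
def belowParabola : Set (EuclideanSpace ℝ (Fin 2)) := {z | z 1 < z 0 ^ 2}

theorem isPreconnected_belowParabola : IsPreconnected belowParabola := by
  have himage : belowParabola =
      (fun w : ℝ × ℝ => !₂[w.1, w.1 ^ 2 - w.2]) '' (Set.univ ×ˢ Set.Ioi 0) := by
    ext z
    constructor
    · intro (hz : z 1 < z 0 ^ 2)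
      refine ⟨(z 0, z 0 ^ 2 - z 1), ⟨trivial, sub_pos.2 hz⟩, ?_⟩
      ext i
      fin_cases i <;> simp
    · rintro ⟨w, ⟨-, hw⟩, rfl⟩
      simpa [belowParabola] using hw
  rw [himage]
  refine (isPreconnected_univ.prod isPreconnected_Ioi).image _ (Continuous.continuousOn ?_)
  fun_prop

theorem not_isBounded_belowParabola : ¬ Bornology.IsBounded belowParabola := by
  intro hbounded
  obtain ⟨R, hR⟩ := hbounded.exists_norm_le
  have hmem : !₂[R + 1, -1] ∈ belowParabola :=
    show -1 < (R + 1) ^ 2 from neg_one_lt_zero.trans_le (sq_nonneg _)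
  have hle : |R + 1| ≤ R := (PiLp.norm_apply_le !₂[R + 1, -1] 0).trans (hR _ hmem)
  linarith [le_abs_self (R + 1)]

theorem parabolaPoint_mem_closure_belowParabola (a : ℝ) :
    parabolaPoint a ∈ closure belowParabola := by
  have hcont : Continuous fun t : ℝ => (!₂[a, a ^ 2 - t] : EuclideanSpace ℝ (Fin 2)) := by
    fun_prop
  have hlim := (hcont.tendsto 0).mono_left (nhdsWithin_le_nhds (s := Set.Ioi 0))
  rw [sub_zero] at hlim
  refine mem_closure_of_tendsto hlim (Filter.eventually_of_mem self_mem_nhdsWithin fun t ht => ?_)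
  simpa [belowParabola] using ht

theorem belowParabola_subset_compl_support {x : V → ℝ} (hx : x.Injective)
    (hG : IsNoncrossing G x) : belowParabola ⊆ (parabolaDrawing hx hG).supportᶜ := by
  rintro z (hz : z 1 < z 0 ^ 2) (⟨v, rfl⟩ | hsupport)
  · exact hz.ne rfl
  · obtain ⟨e, -, hze⟩ := Set.mem_iUnion₂.1 hsupport
    obtain ⟨a, b, hab, rfl⟩ := exists_eq_mk_of_le x e
    obtain ⟨⟨haz, hzb⟩, hz1⟩ := mem_segment_parabolaPoint hab hze
    nlinarith [mul_nonneg (sub_nonneg.2 haz) (sub_nonneg.2 hzb)]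

theorem isOuterplanar_of_isNoncrossing {x : V → ℝ} (hx : x.Injective) (hG : IsNoncrossing G x) :
    G.IsOuterplanar := by
  have hsubset := belowParabola_subset_compl_support hx hG
  have hmem : !₂[0, -1] ∈ belowParabola := by simp [belowParabola]
  have hface := isPreconnected_belowParabola.subset_connectedComponentIn hmem hsubset
  refine ⟨parabolaDrawing hx hG, _, ⟨_, hsubset hmem, rfl⟩,
    fun h => not_isBounded_belowParabola (h.subset hface),
    fun v => ⟨closure_mono hface (parabolaPoint_mem_closure_belowParabola (x v)), fun hv => ?_⟩⟩
  exact connectedComponentIn_subset _ _ (interior_subset hv) (.inl ⟨v, rfl⟩)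

theorem isOuterplanar_ofEdgeList {n : ℕ} {l : List (Fin n × Fin n)} (hlt : ∀ e ∈ l, e.1 < e.2)
    (hl : ∀ e ∈ l, ∀ e' ∈ l, ¬ (e.1 < e'.1 ∧ e'.1 < e.2 ∧ e.2 < e'.2)) :
    (ofEdgeList l).IsOuterplanar := by
  have hx : (fun i : Fin n => (i : ℝ)).Injective := fun i j h => Fin.ext (Nat.cast_injective h)
  refine isOuterplanar_of_isNoncrossing hx fun a b c d hab hcd => ?_
  simp only [Nat.cast_lt, Fin.val_fin_lt]
  rintro ⟨hac, hcb, hbd⟩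
  have habl : (a, b) ∈ l := hab.2.resolve_right fun h => (hlt _ h).not_gt (hac.trans hcb)
  have hcdl : (c, d) ∈ l := hcd.2.resolve_right fun h => (hlt _ h).not_gt (hcb.trans hbd)
  exact hl _ habl _ hcdl ⟨hac, hcb, hbd⟩

set_option maxRecDepth 10000 in
theorem isOuterplanar_pentagonGraph : pentagonGraph.IsOuterplanar :=
  isOuterplanar_ofEdgeList (by decide) (by decide)

end ExactSquareColoring

theorem mainTheorem3 :
    (∀ (V : Type*) [Finite V] (G : SimpleGraph V),
      G.IsSubcubic → G.IsK4MinorFree → G.exactSquareChromaticNumber ≤ 4) ∧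
    (∃ (n : ℕ) (G : SimpleGraph (Fin n)),
      G.IsBipartite ∧ G.IsSubcubic ∧ G.IsK4MinorFree ∧ 6 ≤ G.egirth ∧
        G.exactSquareChromaticNumber = 4) ∧
    (∃ (n : ℕ) (G : SimpleGraph (Fin n)),
      G.IsOuterplanar ∧ G.IsSubcubic ∧ G.IsK4MinorFree ∧
        G.exactSquareChromaticNumber = 4) := by
  open ExactSquareColoring in
  refine ⟨fun V _ G hs hK => ?_, ⟨8, thetaGraph, ?_⟩, ⟨20, pentagonGraph, ?_⟩⟩
  · exact SimpleGraph.chromaticNumber_le_iff_colorable.2 (colorable_exactSquare hs hK)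
  · exact ⟨isBipartite_thetaGraph, isSubcubic_thetaGraph, isK4MinorFree_thetaGraph,
      six_le_egirth_thetaGraph, exactSquareChromaticNumber_eq_four isSubcubic_thetaGraph
        isK4MinorFree_thetaGraph not_colorable_exactSquare_thetaGraph⟩
  · exact ⟨isOuterplanar_pentagonGraph, isSubcubic_pentagonGraph, isK4MinorFree_pentagonGraph,
      exactSquareChromaticNumber_eq_four isSubcubic_pentagonGraph isK4MinorFree_pentagonGraph
        not_colorable_exactSquare_pentagonGraph⟩
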